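/- Let $H\neq\{0\}$ be a finite dimensional real Hilbert space and $A$ a symmetric linear operator on $H$ which is coercive: $(Au,u)\ge \lambda\|u\|^2$ for all $u\in H$ and some $\lambda>0$; write $\|A^{1/2}u\|=(Au,u)^{1/2}$. Let $l>0$, $\beta>0$, $c>0$ and $l<\alpha<\frac{\beta(1+l)+l}{\beta+2}$. Consider the equation $$(\|u'\|^{l}u')'+\|A^{1/2}u\|^\beta Au+c\|u'\|^\alpha u'=0 \quad\text{on } [0,\infty),$$ whose solutions are the functions $u\in C^1([0,\infty),H)$ with $\|u'\|^lu'\in C^1([0,\infty),H)$ that satisfy it for all $t\ge 0$. The energy of a solution is $$E(t)=\frac{l+1}{l+2}\|u'(t)\|^{l+2}+\frac1{\beta+2}\|A^{1/2}u(t)\|^{\beta+2}.$$ A solution is called fast if there are constants $0<m\le M$ with $m\,t^{-\frac{l+2}{\alpha-l}}\le E(t)\le M\,t^{-\frac{l+2}{\alpha-l}}$ for all large $t$, and slow if there are constants $0<m\le M$ with $m\,t^{-\frac{(\alpha+1)(\beta+2)}{\beta-\alpha}}\le E(t)\le M\,t^{-\frac{(\alpha+1)(\beta+2)}{\beta-\alpha}}$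 for all large $t$. Then the equation has infinitely many fast solutions and infinitely many slow solutions. Moreover, for every eigenvector $\varphi$ of $A$, infinitely many fast solutions and infinitely many slow solutions are of the form $u(t)=v(t)\varphi$ with $v$ real-valued. -/

import Mathlib

open Filter Asymptotics Topology

namespace VectorODE

noncomputable section

variable {H : Type*} [NormedAddCommGroup H] [InnerProductSpace ℝ H]

/-- `A` is coercive: `(A u, u) ≥ lam ‖u‖²` for some `lam > 0`. -/
def IsCoerciveOp (A : H →ₗ[ℝ] H) : Prop :=
  ∃ lam : ℝ, 0 < lam ∧ ∀ u : H, lam * ‖u‖ ^ 2 ≤ inner ℝ (A u) u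

/-- The norm `‖A^{1/2} u‖ = (A u, u)^{1/2}` of the form domain of the positive operator `A`. -/
def sqrtNorm (A : H →ₗ[ℝ] H) (u : H) : ℝ :=
  Real.sqrt (inner ℝ (A u) u)

/-- `sqrtNorm A u` is the norm of `B u` for every symmetric square root `B` of `A`. -/
theorem sqrtNorm_eq_norm (A B : H →ₗ[ℝ] H) (hB : B.IsSymmetric) (hBA : B ∘ₗ B = A) (u : H) :
    sqrtNorm A u = ‖B u‖ := by
  have h : inner ℝ (A u) u = ‖B u‖ ^ 2 := by
    rw [← hBA, LinearMap.comp_apply, hB (B u) u, real_inner_self_eq_norm_sq]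
  rw [sqrtNorm, h, Real.sqrt_sq (norm_nonneg _)]

/-- The derivative on the half line `[0, ∞)` (one-sided at `0`). -/
def dt (u : ℝ → H) (t : ℝ) : H :=
  derivWithin u (Set.Ici 0) t

/-- The function `‖u'‖^l u'` on `[0, ∞)`. -/
def momentum (l : ℝ) (u : ℝ → H) (t : ℝ) : H :=
  ‖dt u t‖ ^ l • dt u t

/-- `u` is a solution on `[0, ∞)` of `(‖u'‖^l u')' + ‖A^{1/2} u‖^β A u + g(u') = 0`, in the class
`u ∈ C¹([0, ∞), H)`, `‖u'‖^l u' ∈ C¹([0, ∞), H)`. -/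
structure IsSolution (l β : ℝ) (A : H →ₗ[ℝ] H) (g : H → H) (u : ℝ → H) : Prop where
  contDiffOn : ContDiffOn ℝ 1 u (Set.Ici 0)
  contDiffOn_momentum : ContDiffOn ℝ 1 (momentum l u) (Set.Ici 0)
  equation : ∀ t : ℝ, 0 ≤ t →
    dt (momentum l u) t + sqrtNorm A (u t) ^ β • A (u t) + g (dt u t) = 0

/-- The total energy `E(t) = (l+1)/(l+2) ‖u'(t)‖^{l+2} + 1/(β+2) ‖A^{1/2} u(t)‖^{β+2}`. -/
def energy (l β : ℝ) (A : H →ₗ[ℝ] H) (u : ℝ → H) (t : ℝ) : ℝ :=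
  (l + 1) / (l + 2) * ‖dt u t‖ ^ (l + 2) + 1 / (β + 2) * sqrtNorm A (u t) ^ (β + 2)

/-- The power nonlinearity `g(v) = c ‖v‖^α v`. -/
def powerDamping (c α : ℝ) (v : H) : H :=
  (c * ‖v‖ ^ α) • v

/-- `u` solves the equation with `g(v) = c ‖v‖^α v`, and its energy is comparable to
`t^{-(l+2)/(α-l)}` as `t → ∞` (bounded above and below by positive multiples). -/
def IsFastSolution (l β α c : ℝ) (A : H →ₗ[ℝ] H) (u : ℝ → H) : Prop :=
  IsSolution l β A (powerDamping c α) u ∧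
    energy l β A u =Θ[atTop] fun t : ℝ => t ^ (-((l + 2) / (α - l)))

/-- `u` solves the equation with `g(v) = c ‖v‖^α v`, and its energy is comparable to
`t^{-(α+1)(β+2)/(β-α)}` as `t → ∞`. -/
def IsSlowSolution (l β α c : ℝ) (A : H →ₗ[ℝ] H) (u : ℝ → H) : Prop :=
  IsSolution l β A (powerDamping c α) u ∧
    energy l β A u =Θ[atTop] fun t : ℝ => t ^ (-((α + 1) * (β + 2) / (β - α)))

/-- The functions on `[0, ∞)` obtained by restricting the functions with property `P`
(so that the values at negative times, which carry no meaning, are not counted). -/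
def onHalfLine (P : (ℝ → H) → Prop) : Set (Set.Ici (0 : ℝ) → H) :=
  (Set.Ici (0 : ℝ)).domRestrict '' {u | P u}

/-- `u(t) = v(t) φ` on `[0, ∞)` for some real-valued function `v`. -/
def IsMultipleOf (φ : H) (u : ℝ → H) : Prop :=
  ∃ v : ℝ → ℝ, ∀ t : ℝ, 0 ≤ t → u t = v t • φ

end

end VectorODE

/-!
Along an eigenvector `φ` the equation reduces to a scalar one, and it suffices to find positive
decreasing `v` with `u = v φ`. Such a motion follows an orbit `v' = -W(v)` in the phase plane, where
`W` solves the first-order equation `W' = C W^(α-l) - B s^(β+1) W^(-(l+1))` for small `s > 0`, with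
`W(s) → 0` as `s → 0`. This equation is singular at the origin and has two kinds of solutions there:

* if inertia balances damping, `W` is comparable to `s ^ θ` with `θ = 1 / (l + 1 - α)`;
* if elasticity balances damping, `W` is comparable to `s ^ θ` with `θ = (β + 1) / (α + 1)`.

The upper bound on `α` says exactly that the neglected term is of higher order in each case.
Writing `W(s) = s ^ θ k` and choosing a suitable logarithmic or power-like variable in place of `s`,
both cases become a small non-autonomous perturbation of a scalar equation for `k` with a stable
equilibrium (`exists_fast_orbit`, `exists_slow_orbit`). A solution near the equilibrium is provided
by a contraction argument for Duhamel's formula on the whole line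
(`exists_solution_near_equilibrium`); in the fast case the singular point lies at `-∞`, in the slow
case at `+∞`, and after extending the perturbation one statement covers both.

Since `θ > 1`, the motion along an orbit decays like `t ^ (-1 / (θ - 1))`
(`exists_decaying_motion`), which gives the two energy rates; the starting point on the orbit is
arbitrary, which gives infinitely many solutions (`infinite_solutions_of_orbit`). Symmetry and
finite dimension guarantee that an eigenvector exists.
-/

/-! ### Bounded solutions of perturbed linear scalar equations -/

/-- The solution of `y' = -κ y + f` which is bounded on the whole line, given by Duhamel's formula
started at `-∞`. -/
noncomputable def duhamel (κ : ℝ) (f : ℝ → ℝ) (t : ℝ) : ℝ :=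
  Real.exp (-κ * t) * ∫ s in Set.Iic t, Real.exp (κ * s) * f s

section Duhamel

variable {κ N : ℝ} {f : ℝ → ℝ}

theorem integrableOn_exp_mul_of_bounded (hκ : 0 < κ) (hf : Continuous f) (hN : ∀ t, |f t| ≤ N)
    (t : ℝ) :
    MeasureTheory.IntegrableOn (fun s => Real.exp (κ * s) * f s) (Set.Iic t) := by
  refine MeasureTheory.Integrable.mono' ((integrableOn_exp_mul_Iic hκ t).mul_const N)
    (by fun_prop) (MeasureTheory.ae_of_all _ fun s => ?_)
  rw [Real.norm_eq_abs, abs_mul, Real.abs_exp]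
  exact mul_le_mul_of_nonneg_left (hN s) (Real.exp_pos _).le

theorem abs_duhamel_le (hκ : 0 < κ) (hN : ∀ t, |f t| ≤ N) (t : ℝ) :
    |duhamel κ f t| ≤ N / κ := by
  have h : |∫ s in Set.Iic t, Real.exp (κ * s) * f s| ≤
      ∫ s in Set.Iic t, Real.exp (κ * s) * N := by
    rw [← Real.norm_eq_abs]
    refine MeasureTheory.norm_integral_le_of_norm_le ((integrableOn_exp_mul_Iic hκ t).mul_const N)
      (MeasureTheory.ae_of_all _ fun s => ?_)
    rw [Real.norm_eq_abs, abs_mul, Real.abs_exp]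
    exact mul_le_mul_of_nonneg_left (hN s) (Real.exp_pos _).le
  rw [MeasureTheory.integral_mul_const, integral_exp_mul_Iic hκ] at h
  rw [duhamel, abs_mul, Real.abs_exp]
  calc _ ≤ Real.exp (-κ * t) * (Real.exp (κ * t) / κ * N) := by gcongr
    _ = (Real.exp (-κ * t) * Real.exp (κ * t)) * (N / κ) := by ring
    _ = N / κ := by rw [← Real.exp_add]; simp

theorem duhamel_sub {g : ℝ → ℝ} {N' : ℝ} (hκ : 0 < κ) (hf : Continuous f) (hN : ∀ t, |f t| ≤ N)
    (hg : Continuous g) (hN' : ∀ t, |g t| ≤ N') (t : ℝ) :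
    duhamel κ f t - duhamel κ g t = duhamel κ (fun s => f s - g s) t := by
  simp only [duhamel, mul_sub]
  rw [MeasureTheory.integral_sub (integrableOn_exp_mul_of_bounded hκ hf hN t)
    (integrableOn_exp_mul_of_bounded hκ hg hN' t), mul_sub]

theorem hasDerivAt_duhamel (hκ : 0 < κ) (hf : Continuous f) (hN : ∀ t, |f t| ≤ N) (t : ℝ) :
    HasDerivAt (duhamel κ f) (-κ * duhamel κ f t + f t) t := by
  have hc : Continuous fun s => Real.exp (κ * s) * f s := by fun_prop
  have hI : HasDerivAt (fun t => ∫ s in Set.Iic t, Real.exp (κ * s) * f s)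
      (Real.exp (κ * t) * f t) t := by
    have h := (intervalIntegral.integral_hasDerivAt_right (hc.intervalIntegrable 0 t)
      (hc.stronglyMeasurableAtFilter _ _) hc.continuousAt).const_add
      (∫ s in Set.Iic 0, Real.exp (κ * s) * f s)
    refine h.congr_of_eventuallyEq (Eventually.of_forall fun x => ?_)
    have := intervalIntegral.integral_Iic_sub_Iic (integrableOn_exp_mul_of_bounded hκ hf hN 0)
      (integrableOn_exp_mul_of_bounded hκ hf hN x)
    simp only
    linarith
  have hE : HasDerivAt (fun t : ℝ => Real.exp (-κ * t)) (Real.exp (-κ * t) * (-κ * 1)) t :=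
    ((hasDerivAt_id t).const_mul (-κ)).exp
  refine (hE.mul hI).congr_deriv ?_
  have h1 : Real.exp (-κ * t) * Real.exp (κ * t) = 1 := by rw [← Real.exp_add]; simp
  rw [duhamel]
  linear_combination f t * h1

end Duhamel

/-- Existence of a bounded global solution of `g' = -κ g + F(t, g)` when the Lipschitz constant of
`F` is smaller than `κ`: Duhamel's formula is then a contraction for the sup norm on the line. -/
theorem exists_bounded_solution {κ L r : ℝ} {F : ℝ → ℝ → ℝ} (hL : 0 ≤ L) (hLκ : L < κ)
    (hF : ∀ g : ℝ → ℝ, Continuous g → Continuous fun t => F t (g t))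
    (hb : ∀ t x, |F t x| ≤ κ * r) (hlip : ∀ t x y, |F t x - F t y| ≤ L * |x - y|) :
    ∃ g : ℝ → ℝ, ∀ t, |g t| ≤ r ∧ HasDerivAt g (-κ * g t + F t (g t)) t := by
  have hκ : 0 < κ := hL.trans_lt hLκ
  have hder (g : BoundedContinuousFunction ℝ ℝ) (t : ℝ) :=
    hasDerivAt_duhamel hκ (hF g g.continuous) (fun t => hb t (g t)) t
  have hbound (g : BoundedContinuousFunction ℝ ℝ) (t : ℝ) :
      |duhamel κ (fun t => F t (g t)) t| ≤ r := by
    have := abs_duhamel_le hκ (fun t => hb t (g t)) t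
    rwa [mul_div_cancel_left₀ _ hκ.ne'] at this
  let T : BoundedContinuousFunction ℝ ℝ → BoundedContinuousFunction ℝ ℝ := fun g =>
    BoundedContinuousFunction.ofNormedAddCommGroup (duhamel κ fun t => F t (g t))
      (continuous_iff_continuousAt.2 fun t => (hder g t).continuousAt) r (hbound g)
  obtain ⟨q, hq⟩ : ∃ q : NNReal, (q : ℝ) = L / κ := ⟨⟨L / κ, div_nonneg hL hκ.le⟩, rfl⟩
  have hT : ContractingWith q T := by
    refine ⟨?_, LipschitzWith.of_dist_le_mul fun g₁ g₂ => ?_⟩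
    · rw [← NNReal.coe_lt_coe, hq]
      exact (div_lt_one hκ).2 hLκ
    · rw [hq]
      refine (BoundedContinuousFunction.dist_le (by positivity)).2 fun t => ?_
      change |duhamel κ _ t - duhamel κ _ t| ≤ L / κ * dist g₁ g₂
      rw [duhamel_sub hκ (hF g₁ g₁.continuous) (fun t => hb t (g₁ t)) (hF g₂ g₂.continuous)
        (fun t => hb t (g₂ t)), div_mul_eq_mul_div]
      refine abs_duhamel_le hκ (fun s => (hlip s _ _).trans ?_) t
      exact mul_le_mul_of_nonneg_left (g₁.dist_coe_le_dist s) hL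
  obtain ⟨g, hg⟩ : ∃ g, T g = g := ⟨_, hT.fixedPoint_isFixedPt⟩
  have hg' : duhamel κ (fun t => F t (g t)) = g := congrArg DFunLike.coe hg
  refine ⟨g, fun t => ⟨?_, ?_⟩⟩
  · have := hbound g t
    rwa [hg'] at this
  · have := hder g t
    rwa [hg'] at this

/-- A small time-dependent perturbation of an autonomous equation `k' = f(k)` with a stable
hyperbolic equilibrium `k₀` has a global solution that stays near `k₀`. -/
theorem exists_solution_near_equilibrium {f p : ℝ → ℝ} {k₀ κ p' ρ : ℝ} (hκ : 0 < κ)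
    (hf : HasStrictDerivAt f (-κ) k₀) (hf₀ : f k₀ = 0) (hp : HasStrictDerivAt p p' k₀)
    (hρ : 0 < ρ) :
    ∃ η > 0, ∀ e : ℝ → ℝ, Continuous e → (∀ t, |e t| ≤ η) →
      ∃ k : ℝ → ℝ, ∀ t, |k t - k₀| ≤ ρ ∧ HasDerivAt k (f (k t) + e t * p (k t)) t := by
  have hG : HasStrictDerivAt (fun x => f x + κ * (x - k₀)) 0 k₀ := by
    have h := (hasStrictDerivAt_id k₀).sub_const k₀
    exact (hf.add (HasStrictDerivAt.const_mul κ h)).congr_deriv (by ring)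
  -- the nonlinear part of `f` at `k₀` has an arbitrarily small Lipschitz constant
  obtain ⟨q, hq⟩ : ∃ q : NNReal, (q : ℝ) = κ / 4 := ⟨⟨κ / 4, by positivity⟩, rfl⟩
  obtain ⟨S₁, hS₁, hl₁⟩ := hG.hasStrictFDerivAt.exists_lipschitzOnWith_of_nnnorm_lt q
    (by rw [← NNReal.coe_lt_coe, hq]; simpa using hκ)
  obtain ⟨K, S₂, hS₂, hl₂⟩ := hp.hasStrictFDerivAt.exists_lipschitzOnWith
  obtain ⟨r₀, hr₀, hball⟩ := Metric.mem_nhds_iff.1 (inter_mem hS₁ hS₂)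
  set r := min ρ (r₀ / 2) with hr
  have hrpos : 0 < r := lt_min hρ (by positivity)
  have hmem : ∀ x, |x| ≤ r → k₀ + x ∈ S₁ ∩ S₂ := fun x hx => hball <| by
    rw [Metric.mem_ball, Real.dist_eq, add_sub_cancel_left]
    linarith [min_le_right ρ (r₀ / 2)]
  have hG' : ∀ x y, |x| ≤ r → |y| ≤ r →
      |(f (k₀ + x) + κ * x) - (f (k₀ + y) + κ * y)| ≤ κ / 4 * |x - y| := fun x y hx hy => by
    have := hl₁.dist_le_mul _ (hmem x hx).1 _ (hmem y hy).1
    simpa [hq, Real.dist_eq] using this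
  have hp' : ∀ x y, |x| ≤ r → |y| ≤ r → |p (k₀ + x) - p (k₀ + y)| ≤ K * |x - y| :=
    fun x y hx hy => by
      have := hl₂.dist_le_mul _ (hmem x hx).2 _ (hmem y hy).2
      simpa [Real.dist_eq] using this
  -- truncation to `[-r, r]`; the solution found stays in this range, where it has no effect
  let cl : ℝ → ℝ := fun x => max (-r) (min r x)
  have hcl : ∀ x, |cl x| ≤ r := fun x =>
    abs_le.2 ⟨le_max_left _ _, max_le (by linarith) (min_le_left _ _)⟩
  have hcl_lip : ∀ x y, |cl x - cl y| ≤ |x - y| := fun x y =>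
    (abs_max_sub_max_le_max _ _ _ _).trans <| by
      have := abs_min_sub_min_le_max r x r y
      simpa using this
  have hcl_cont : Continuous cl := by fun_prop
  have hcl_eq : ∀ x, |x| ≤ r → cl x = x := fun x hx => by
    have := abs_le.1 hx
    simp only [cl, min_eq_right this.2, max_eq_right this.1]
  obtain ⟨η, hη, hη₁⟩ : ∃ η > 0, η * (K + |p k₀| / r) ≤ κ / 4 := by
    refine ⟨κ / 4 / (K + |p k₀| / r + 1), by positivity, ?_⟩
    rw [div_mul_eq_mul_div, div_le_iff₀ (by positivity)]
    nlinarith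
  refine ⟨η, hη, fun e he heη => ?_⟩
  have hηK : η * K ≤ κ / 4 := le_trans
    (mul_le_mul_of_nonneg_left (le_add_of_nonneg_right (by positivity)) hη.le) hη₁
  let F : ℝ → ℝ → ℝ := fun t x => (f (k₀ + cl x) + κ * cl x) + e t * p (k₀ + cl x)
  have hF : ∀ g : ℝ → ℝ, Continuous g → Continuous fun t => F t (g t) := by
    intro g hg
    have h1 : Continuous fun t => f (k₀ + cl (g t)) + κ * (k₀ + cl (g t) - k₀) :=
      hl₁.continuousOn.comp_continuous (by fun_prop) fun t => (hmem _ (hcl _)).1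
    have h2 : Continuous fun t => p (k₀ + cl (g t)) :=
      hl₂.continuousOn.comp_continuous (by fun_prop) fun t => (hmem _ (hcl _)).2
    simp only [add_sub_cancel_left] at h1
    exact h1.add (he.mul h2)
  have hb : ∀ t x, |F t x| ≤ κ * r := by
    intro t x
    have h1 := hG' (cl x) 0 (hcl x) (by simpa using hrpos.le)
    have h2 := hp' (cl x) 0 (hcl x) (by simpa using hrpos.le)
    simp only [add_zero, mul_zero, hf₀, sub_zero] at h1 h2
    have h3 : |p (k₀ + cl x)| ≤ |p k₀| + K * r := by
      have := abs_sub_abs_le_abs_sub (p (k₀ + cl x)) (p k₀)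
      have := mul_le_mul_of_nonneg_left (hcl x) K.coe_nonneg
      linarith
    calc _ ≤ |f (k₀ + cl x) + κ * cl x| + |e t| * |p (k₀ + cl x)| := by
          rw [← abs_mul]; exact abs_add_le _ _
      _ ≤ κ / 4 * r + η * (|p k₀| + K * r) := by
          refine add_le_add (h1.trans ?_) (mul_le_mul (heη t) h3 (abs_nonneg _) hη.le)
          exact mul_le_mul_of_nonneg_left (hcl x) (by positivity)
      _ = κ / 4 * r + η * (K + |p k₀| / r) * r := by field_simp; ring
      _ ≤ κ / 4 * r + κ / 4 * r := by gcongr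
      _ ≤ κ * r := by nlinarith
  have hlip : ∀ t x y, |F t x - F t y| ≤ κ / 2 * |x - y| := by
    intro t x y
    have h1 := hG' (cl x) (cl y) (hcl x) (hcl y)
    have h2 := hp' (cl x) (cl y) (hcl x) (hcl y)
    calc _ = |((f (k₀ + cl x) + κ * cl x) - (f (k₀ + cl y) + κ * cl y)) +
            e t * (p (k₀ + cl x) - p (k₀ + cl y))| := by congr 1; ring
      _ ≤ κ / 4 * |cl x - cl y| + η * (K * |cl x - cl y|) := by
          refine (abs_add_le _ _).trans (add_le_add h1 ?_)
          rw [abs_mul]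
          exact mul_le_mul (heη t) h2 (abs_nonneg _) hη.le
      _ = (κ / 4 + η * K) * |cl x - cl y| := by ring
      _ ≤ κ / 2 * |x - y| :=
          mul_le_mul (by linarith) (hcl_lip x y) (abs_nonneg _) (by positivity)
  obtain ⟨g, hg⟩ := exists_bounded_solution (by positivity) (by linarith) hF hb hlip
  refine ⟨fun t => k₀ + g t, fun t => ⟨?_, ?_⟩⟩
  · rw [add_sub_cancel_left]
    exact (hg t).1.trans (min_le_left _ _)
  · refine ((hg t).2.const_add k₀).congr_deriv ?_
    simp only [F]
    rw [hcl_eq _ (hg t).1]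
    ring

/-! ### Motion along a given orbit -/

/-- A scalar autonomous equation with a continuous right-hand side between two positive constants
is solved by separation of variables. -/
theorem exists_solution_of_pos_of_continuous {R : ℝ → ℝ} {m M : ℝ} (hm : 0 < m)
    (hR : Continuous R) (hmR : ∀ x, m ≤ R x) (hRM : ∀ x, R x ≤ M) (x₀ : ℝ) :
    ∃ x : ℝ → ℝ, x 0 = x₀ ∧ ∀ t, HasDerivAt x (R (x t)) t := by
  have hpos : ∀ x, 0 < R x := fun x => hm.trans_le (hmR x)
  have hc : Continuous fun x => (R x)⁻¹ := hR.inv₀ fun x => (hpos x).ne'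
  set G : ℝ → ℝ := fun x => ∫ s in x₀..x, (R s)⁻¹ with hG
  have hGd : ∀ x, HasDerivAt G (R x)⁻¹ x := fun x =>
    intervalIntegral.integral_hasDerivAt_right (hc.intervalIntegrable _ _)
      (hc.stronglyMeasurableAtFilter _ _) hc.continuousAt
  have hM : 0 < M := (hpos 0).trans_le (hRM 0)
  have hG_diff : Differentiable ℝ G := fun x => (hGd x).differentiableAt
  have hG_mono : StrictMono G := strictMono_of_deriv_pos fun x => by
    rw [(hGd x).deriv]; exact inv_pos.2 (hpos x)
  have hG_lower : ∀ ⦃x y⦄, x ≤ y → M⁻¹ * (y - x) ≤ G y - G x :=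
    mul_sub_le_image_sub_of_le_deriv hG_diff fun x => by
      rw [(hGd x).deriv]; exact inv_anti₀ (hpos x) (hRM x)
  have hG_surj : Function.Surjective G := by
    have h0 : G x₀ = 0 := intervalIntegral.integral_same
    refine hG_diff.continuous.surjective ?_ ?_
    · refine tendsto_atTop_mono' _ ?_
        ((tendsto_id.atTop_add tendsto_const_nhds : Tendsto (fun x => x + -x₀) _ _).const_mul_atTop
          (inv_pos.2 hM))
      filter_upwards [eventually_ge_atTop x₀] with x hx
      have := hG_lower hx
      simpa [h0, sub_eq_add_neg] using this
    · refine tendsto_atBot_mono' _ ?_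
        ((tendsto_id.atBot_add tendsto_const_nhds : Tendsto (fun x => x + -x₀) _ _).const_mul_atBot
          (inv_pos.2 hM))
      filter_upwards [eventually_le_atBot x₀] with x hx
      have := hG_lower hx
      rw [h0] at this
      simp only [id]
      linarith
  let e := hG_mono.orderIsoOfSurjective G hG_surj
  have he : ∀ t, G (e.symm t) = t := fun t => e.apply_symm_apply t
  refine ⟨e.symm, ?_, fun t => ?_⟩
  · rw [OrderIso.symm_apply_eq]
    exact (intervalIntegral.integral_same (a := x₀)).symm
  · have := (hGd (e.symm t)).of_local_left_inverse e.symm.continuous.continuousAt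
      (inv_ne_zero (hpos _).ne') (Eventually.of_forall he)
    simpa using this

/-- A quantity moving with speed `-W(v)` where `W(s)` is comparable to `s ^ θ`, `θ > 1`, stays
positive and decays like `t ^ (-1 / (θ - 1))`. In the variable `x = v ^ (-(θ - 1))` the speed
is bounded above and below by positive constants. -/
theorem exists_decaying_motion {W : ℝ → ℝ} {s₀ θ m M : ℝ} (hθ : 1 < θ) (hm : 0 < m)
    (hW : ContinuousOn W (Set.Ioo 0 s₀))
    (hmW : ∀ s ∈ Set.Ioo 0 s₀, m * s ^ θ ≤ W s) (hWM : ∀ s ∈ Set.Ioo 0 s₀, W s ≤ M * s ^ θ)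
    {v₀ : ℝ} (hv₀ : v₀ ∈ Set.Ioo 0 s₀) :
    ∃ v : ℝ → ℝ, v 0 = v₀ ∧
      (∀ t, 0 ≤ t → v t ∈ Set.Ioo 0 s₀ ∧ HasDerivAt v (-W (v t)) t) ∧
      v =Θ[atTop] fun t => t ^ (-(1 / (θ - 1))) := by
  have hθ' : 0 < θ - 1 := by linarith
  set γ := 1 / (θ - 1) with hγ
  have hγpos : 0 < γ := by positivity
  have hγθ : γ * (θ - 1) = 1 := by rw [hγ]; field_simp
  set x₀ := v₀ ^ (-(θ - 1)) with hx₀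
  have hx₀pos : 0 < x₀ := Real.rpow_pos_of_pos hv₀.1 _
  have hx₀v : x₀ ^ (-γ) = v₀ := by
    rw [hx₀, ← Real.rpow_mul hv₀.1.le, show -(θ - 1) * -γ = 1 by linarith, Real.rpow_one]
  -- `v` as a function of `x`, frozen below the initial value `x₀`, which `x` never passes
  let s : ℝ → ℝ := fun x => (max x x₀) ^ (-γ)
  have hmaxpos : ∀ x, 0 < max x x₀ := fun x => lt_max_of_lt_right hx₀pos
  have hs_mem : ∀ x, s x ∈ Set.Ioo 0 s₀ := fun x => by
    refine ⟨Real.rpow_pos_of_pos (hmaxpos x) _, lt_of_le_of_lt ?_ hv₀.2⟩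
    rw [← hx₀v]
    exact Real.rpow_le_rpow_of_nonpos hx₀pos (le_max_right _ _) (by linarith)
  have hs_cont : Continuous s :=
    (continuous_id.max continuous_const).rpow_const fun x => Or.inl (hmaxpos x).ne'
  let R : ℝ → ℝ := fun x => (θ - 1) * (s x ^ (-θ) * W (s x))
  have hss : ∀ x, s x ^ (-θ) * s x ^ θ = 1 := fun x => by
    rw [← Real.rpow_add (hs_mem x).1]; simp
  have hR_cont : Continuous R :=
    continuous_const.mul ((hs_cont.rpow_const fun x => Or.inl (hs_mem x).1.ne').mul
      (hW.comp_continuous hs_cont hs_mem))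
  have hRm : ∀ x, (θ - 1) * m ≤ R x := fun x => by
    refine mul_le_mul_of_nonneg_left ?_ hθ'.le
    calc m = s x ^ (-θ) * (m * s x ^ θ) := by linear_combination -m * hss x
      _ ≤ _ := mul_le_mul_of_nonneg_left (hmW _ (hs_mem x))
          (Real.rpow_nonneg (hs_mem x).1.le _)
  have hRM : ∀ x, R x ≤ (θ - 1) * M := fun x => by
    refine mul_le_mul_of_nonneg_left ?_ hθ'.le
    calc s x ^ (-θ) * W (s x) ≤ s x ^ (-θ) * (M * s x ^ θ) :=
          mul_le_mul_of_nonneg_left (hWM _ (hs_mem x)) (Real.rpow_nonneg (hs_mem x).1.le _)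
      _ = M := by linear_combination M * hss x
  have hmpos : 0 < (θ - 1) * m := by positivity
  obtain ⟨x, hx0, hx⟩ := exists_solution_of_pos_of_continuous hmpos hR_cont hRm hRM x₀
  have hx_diff : Differentiable ℝ x := fun t => (hx t).differentiableAt
  have hx_lower : ∀ t, 0 ≤ t → x₀ + (θ - 1) * m * t ≤ x t := fun t ht => by
    have := mul_sub_le_image_sub_of_le_deriv hx_diff (C := (θ - 1) * m)
      (fun t => by rw [(hx t).deriv]; exact hRm _) ht
    rw [hx0] at this
    linarith
  have hx_upper : ∀ t, 0 ≤ t → x t ≤ x₀ + (θ - 1) * M * t := fun t ht => by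
    have := image_sub_le_mul_sub_of_deriv_le hx_diff (C := (θ - 1) * M)
      (fun t => by rw [(hx t).deriv]; exact hRM _) ht
    rw [hx0] at this
    linarith
  have hx_ge : ∀ t, 0 ≤ t → x₀ ≤ x t := fun t ht =>
    le_trans (by have := mul_nonneg hmpos.le ht; linarith) (hx_lower t ht)
  have hsx : ∀ t, 0 ≤ t → s (x t) = x t ^ (-γ) := fun t ht => by
    simp only [s, max_eq_left (hx_ge t ht)]
  refine ⟨fun t => x t ^ (-γ), ?_, fun t ht => ⟨?_, ?_⟩, ?_⟩
  · simp only [hx0, hx₀v]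
  · have := hs_mem (x t)
    rwa [hsx t ht] at this
  · have hxt : 0 < x t := hx₀pos.trans_le (hx_ge t ht)
    refine ((hx t).rpow_const (p := -γ) (Or.inl hxt.ne')).congr_deriv ?_
    simp only [R, hsx t ht]
    rw [← Real.rpow_mul hxt.le]
    have h1 : x t ^ (-γ * -θ) * x t ^ (-γ - 1) = 1 := by
      rw [← Real.rpow_add hxt, show -γ * -θ + (-γ - 1) = 0 by linarith, Real.rpow_zero]
    linear_combination (-W (x t ^ (-γ)) * (γ * (θ - 1))) * h1 - W (x t ^ (-γ)) * hγθ
  · have hxt : x =Θ[atTop] fun t => t := by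
      refine ⟨IsBigO.of_bound (x₀ + (θ - 1) * M) ?_, IsBigO.of_bound ((θ - 1) * m)⁻¹ ?_⟩
      · filter_upwards [eventually_ge_atTop 1] with t ht
        rw [Real.norm_eq_abs, Real.norm_eq_abs, abs_of_nonneg (by linarith : (0 : ℝ) ≤ t),
          abs_of_nonneg (hx₀pos.le.trans (hx_ge t (by linarith)))]
        have := hx_upper t (by linarith)
        nlinarith
      · filter_upwards [eventually_ge_atTop 1] with t ht
        rw [Real.norm_eq_abs, Real.norm_eq_abs, abs_of_nonneg (by linarith : (0 : ℝ) ≤ t),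
          abs_of_nonneg (hx₀pos.le.trans (hx_ge t (by linarith))), inv_mul_eq_div,
          le_div_iff₀ hmpos]
        have := hx_lower t (by linarith)
        linarith
    refine hxt.rpow ?_ (eventually_ge_atTop 0)
    filter_upwards [eventually_ge_atTop 0] with t ht using hx₀pos.le.trans (hx_ge t ht)

/-! ### Two orbits through the origin of the phase plane -/

/-- `W` describes the orbit `v' = -W(v)`, `0 < v < s₀`, of a decaying positive solution of
`(|v'|^l v')' / (l + 1) + B v^(β+1) + C |v'|^α v' = 0`, and `W(s)` is comparable to `s ^ θ`. -/
structure IsOrbit (l α β C B θ m M s₀ : ℝ) (W : ℝ → ℝ) : Prop where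
  lower : ∀ s ∈ Set.Ioo 0 s₀, m * s ^ θ ≤ W s
  upper : ∀ s ∈ Set.Ioo 0 s₀, W s ≤ M * s ^ θ
  hasDerivAt : ∀ s ∈ Set.Ioo 0 s₀,
    HasDerivAt W (C * W s ^ (α - l) - B * s ^ (β + 1) * W s ^ (-(l + 1))) s

section Orbits

variable {l α β C B : ℝ}

/-- The slow orbit: elasticity and damping balance. With `W(s) = s ^ θ k(τ)` and `τ = s ^ (-ε) / ε`
the orbit equation becomes `k' = -(C k^(α-l) - B k^(-(l+1))) + θ k / (ε τ)`, for which the balance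
`C k^(α+1) = B` is a stable equilibrium up to a vanishing perturbation. -/
theorem exists_slow_orbit (hl : 0 < l) (hlα : l < α) (hβ : 0 < β) (hC : 0 < C) (hB : 0 < B)
    (hθ : 1 < (β + 1) / (α + 1) * (l + 1 - α)) :
    ∃ m > 0, ∃ M, ∃ s₀ > 0, ∃ W : ℝ → ℝ, IsOrbit l α β C B ((β + 1) / (α + 1)) m M s₀ W := by
  set θ := (β + 1) / (α + 1) with hθdef
  have hα1 : 0 < α + 1 := by linarith
  have hθpos : 0 < θ := by positivity
  have hθα : θ * (α + 1) = β + 1 := by rw [hθdef]; field_simp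
  set ε := θ * (l + 1 - α) - 1 with hε
  have hεpos : 0 < ε := by linarith
  set k₀ := (B / C) ^ (1 / (α + 1)) with hk₀
  have hk₀pos : 0 < k₀ := Real.rpow_pos_of_pos (by positivity) _
  have hk₀α : C * k₀ ^ (α + 1) = B := by
    rw [hk₀, ← Real.rpow_mul (by positivity), one_div_mul_cancel hα1.ne', Real.rpow_one]
    field_simp
  let f : ℝ → ℝ := fun k => -(C * k ^ (α - l) - B * k ^ (-(l + 1)))
  have hf₀ : f k₀ = 0 := by
    have : k₀ ^ (α - l) = k₀ ^ (α + 1) * k₀ ^ (-(l + 1)) := by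
      rw [← Real.rpow_add hk₀pos]; congr 1; ring
    simp only [f, this]
    linear_combination (-k₀ ^ (-(l + 1))) * hk₀α
  have hf : HasStrictDerivAt f (-(C * ((α - l) * k₀ ^ (α - l - 1)) +
      B * ((l + 1) * k₀ ^ (-(l + 1) - 1)))) k₀ := by
    have h1 := (Real.hasStrictDerivAt_rpow_const_of_ne hk₀pos.ne' (α - l)).const_mul C
    have h2 := (Real.hasStrictDerivAt_rpow_const_of_ne hk₀pos.ne' (-(l + 1))).const_mul B
    exact (h1.sub h2).neg.congr_deriv (by ring)
  have hκ : 0 < C * ((α - l) * k₀ ^ (α - l - 1)) + B * ((l + 1) * k₀ ^ (-(l + 1) - 1)) := by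
    have h1 := Real.rpow_pos_of_pos hk₀pos (α - l - 1)
    have h2 := Real.rpow_pos_of_pos hk₀pos (-(l + 1) - 1)
    have h3 : 0 < α - l := by linarith
    positivity
  obtain ⟨η, hη, H⟩ := exists_solution_near_equilibrium hκ hf hf₀ (hasStrictDerivAt_id k₀)
    (half_pos hk₀pos)
  -- for `τ ≥ τ₀` the coefficient `θ / (ε τ)` is at most `η`; it is frozen for `τ ≤ τ₀`
  set τ₀ := θ / (ε * η) with hτ₀
  have hτ₀pos : 0 < τ₀ := by positivity
  have hmax : ∀ τ : ℝ, 0 < max τ τ₀ := fun τ => lt_max_of_lt_right hτ₀pos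
  obtain ⟨k, hk⟩ := H (fun τ => θ / (ε * max τ τ₀))
    (continuous_const.div (by fun_prop) fun τ => (mul_pos hεpos (hmax τ)).ne') fun τ => by
      rw [abs_of_pos (div_pos hθpos (mul_pos hεpos (hmax τ))),
        div_le_iff₀ (mul_pos hεpos (hmax τ))]
      calc θ = η * (ε * τ₀) := by rw [hτ₀]; field_simp
        _ ≤ _ := by gcongr; exact le_max_right _ _
  have hk_mem := fun τ => abs_le.1 (hk τ).1
  -- `s < s₀` corresponds to `τ > τ₀`
  refine ⟨k₀ / 2, by positivity, 3 * k₀ / 2, (ε * τ₀) ^ (-(1 / ε)),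
    Real.rpow_pos_of_pos (by positivity) _, fun s => s ^ θ * k (s ^ (-ε) / ε), ?_, ?_, ?_⟩
  · intro s hs
    rw [mul_comm]
    exact mul_le_mul_of_nonneg_left (by linarith [(hk_mem (s ^ (-ε) / ε)).1])
      (Real.rpow_nonneg hs.1.le _)
  · intro s hs
    rw [mul_comm]
    exact mul_le_mul_of_nonneg_right (by linarith [(hk_mem (s ^ (-ε) / ε)).2])
      (Real.rpow_nonneg hs.1.le _)
  · rintro s ⟨hs, hs₀⟩
    have hτ : τ₀ ≤ s ^ (-ε) / ε := by
      rw [le_div_iff₀ hεpos, mul_comm]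
      have := Real.rpow_le_rpow_of_nonpos hs hs₀.le (neg_nonpos.2 hεpos.le)
      rwa [← Real.rpow_mul (by positivity), show -(1 / ε) * -ε = 1 by field_simp,
        Real.rpow_one] at this
    set τ := s ^ (-ε) / ε with hτdef
    have hkpos : 0 < k τ := by linarith [(hk_mem τ).1]
    have hkd := (hk τ).2
    have he : θ / (ε * max τ τ₀) = θ * s ^ ε := by
      rw [max_eq_left hτ, hτdef, Real.rpow_neg hs.le]
      have := Real.rpow_pos_of_pos hs ε
      field_simp
    simp only [he] at hkd
    have hsτ : HasDerivAt (fun s : ℝ => s ^ (-ε) / ε) (-ε * s ^ (-ε - 1) / ε) s :=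
      (Real.hasDerivAt_rpow_const (Or.inl hs.ne')).div_const ε
    have hW := (Real.hasDerivAt_rpow_const (p := θ) (Or.inl hs.ne')).mul
      (HasDerivAt.comp s hkd hsτ)
    refine hW.congr_deriv ?_
    simp only [Function.comp, ← hτdef]
    rw [Real.mul_rpow (by positivity) hkpos.le, Real.mul_rpow (by positivity) hkpos.le,
      ← Real.rpow_mul hs.le, ← Real.rpow_mul hs.le]
    have e1 : s ^ (θ - 1) = s ^ θ * s ^ ε * s ^ (-ε - 1) := by
      rw [← Real.rpow_add hs, ← Real.rpow_add hs]; congr 1; ring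
    have e2 : s ^ (θ * (α - l)) = s ^ θ * s ^ (-ε - 1) := by
      rw [← Real.rpow_add hs]; congr 1; linear_combination -hε
    have e3 : s ^ (β + 1) * s ^ (θ * -(l + 1)) = s ^ θ * s ^ (-ε - 1) := by
      rw [← Real.rpow_add hs, ← Real.rpow_add hs]; congr 1; linear_combination -hε - hθα
    have e4 : -ε * s ^ (-ε - 1) / ε = -s ^ (-ε - 1) := by field_simp
    rw [e4]
    simp only [f, id]
    linear_combination θ * k τ * e1 - C * k τ ^ (α - l) * e2 + B * k τ ^ (-(l + 1)) * e3

/-- The fast orbit: inertia and damping balance. With `W(s) = s ^ θ k(log s)` the orbit equation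
becomes `k' = C k^(α-l) - θ k - B e^(δ τ) k^(-(l+1))`, which as `τ → -∞` is a vanishing
perturbation of an equation with a stable equilibrium. -/
theorem exists_fast_orbit (hα : α < l + 1) (hC : 0 < C)
    (hδ : 1 / (l + 1 - α) * (l + 2) < β + 2) :
    ∃ m > 0, ∃ M, ∃ s₀ > 0, ∃ W : ℝ → ℝ, IsOrbit l α β C B (1 / (l + 1 - α)) m M s₀ W := by
  set θ := 1 / (l + 1 - α) with hθdef
  have hα1 : 0 < l + 1 - α := by linarith
  have hθpos : 0 < θ := by positivity
  have hθα : θ * (l + 1 - α) = 1 := by rw [hθdef]; field_simp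
  set δ := β + 2 - θ * (l + 2) with hδdef
  have hδpos : 0 < δ := by linarith
  set k₀ := (C / θ) ^ θ with hk₀
  have hk₀pos : 0 < k₀ := Real.rpow_pos_of_pos (by positivity) _
  have hk₀α : C * k₀ ^ (α - l - 1) = θ := by
    rw [hk₀, ← Real.rpow_mul (by positivity), show θ * (α - l - 1) = -1 by linarith,
      Real.rpow_neg_one]
    field_simp
  let f : ℝ → ℝ := fun k => C * k ^ (α - l) - θ * k
  have hf₀ : f k₀ = 0 := by
    have : k₀ ^ (α - l) = k₀ ^ (α - l - 1) * k₀ := by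
      rw [← Real.rpow_add_one hk₀pos.ne']; congr 1; ring
    simp only [f, this]
    linear_combination k₀ * hk₀α
  have hf : HasStrictDerivAt f (-1) k₀ := by
    have h1 := (Real.hasStrictDerivAt_rpow_const_of_ne hk₀pos.ne' (α - l)).const_mul C
    have h2 := HasStrictDerivAt.const_mul θ (hasStrictDerivAt_id k₀)
    exact (h1.sub h2).congr_deriv (by linear_combination (α - l) * hk₀α - hθα)
  have hp := (Real.hasStrictDerivAt_rpow_const_of_ne hk₀pos.ne' (-(l + 1))).const_mul (-B)
  obtain ⟨η, hη, H⟩ := exists_solution_near_equilibrium one_pos hf hf₀ hp (half_pos hk₀pos)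
  -- for `τ ≤ τ₀` the coefficient `e^(δ τ)` is at most `η`; it is frozen for `τ ≥ τ₀`
  set τ₀ := Real.log η / δ with hτ₀
  obtain ⟨k, hk⟩ := H (fun τ => Real.exp (δ * min τ τ₀)) (by fun_prop) fun τ => by
    rw [Real.abs_exp, ← Real.le_log_iff_exp_le hη]
    calc δ * min τ τ₀ ≤ δ * τ₀ := by gcongr; exact min_le_right _ _
      _ = Real.log η := by rw [hτ₀]; field_simp
  have hk_mem := fun τ => abs_le.1 (hk τ).1
  refine ⟨k₀ / 2, by positivity, 3 * k₀ / 2, Real.exp τ₀, Real.exp_pos _,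
    fun s => s ^ θ * k (Real.log s), ?_, ?_, ?_⟩
  · intro s hs
    rw [mul_comm]
    exact mul_le_mul_of_nonneg_left (by linarith [(hk_mem (Real.log s)).1])
      (Real.rpow_nonneg hs.1.le _)
  · intro s hs
    rw [mul_comm]
    exact mul_le_mul_of_nonneg_right (by linarith [(hk_mem (Real.log s)).2])
      (Real.rpow_nonneg hs.1.le _)
  · rintro s ⟨hs, hs₀⟩
    have hτ : Real.log s ≤ τ₀ := (Real.log_le_iff_le_exp hs).2 hs₀.le
    have hkpos : 0 < k (Real.log s) := by linarith [(hk_mem (Real.log s)).1]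
    have hkd := (hk (Real.log s)).2
    have he : Real.exp (δ * min (Real.log s) τ₀) = s ^ δ := by
      rw [min_eq_left hτ, Real.rpow_def_of_pos hs, mul_comm]
    simp only [he] at hkd
    have hW := (Real.hasDerivAt_rpow_const (p := θ) (Or.inl hs.ne')).mul
      (HasDerivAt.comp s hkd (Real.hasDerivAt_log hs.ne'))
    refine hW.congr_deriv ?_
    simp only [Function.comp]
    rw [Real.mul_rpow (by positivity) hkpos.le, Real.mul_rpow (by positivity) hkpos.le,
      ← Real.rpow_mul hs.le, ← Real.rpow_mul hs.le, ← Real.rpow_neg_one s]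
    have e1 : s ^ (θ - 1) = s ^ θ * s ^ (-1 : ℝ) := by
      rw [← Real.rpow_add hs]; congr 1
    have e2 : s ^ (θ * (α - l)) = s ^ θ * s ^ (-1 : ℝ) := by
      rw [← Real.rpow_add hs]; congr 1; linear_combination -hθα
    have e3 : s ^ (β + 1) * s ^ (θ * -(l + 1)) = s ^ θ * s ^ δ * s ^ (-1 : ℝ) := by
      rw [← Real.rpow_add hs, ← Real.rpow_add hs, ← Real.rpow_add hs]; congr 1
      linear_combination -hδdef
    simp only [f]
    linear_combination θ * k (Real.log s) * e1 - C * k (Real.log s) ^ (α - l) * e2 +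
      B * k (Real.log s) ^ (-(l + 1)) * e3

end Orbits

/-! ### Solutions along an eigenvector -/

open VectorODE

section Eigenvector

variable {H : Type*} [NormedAddCommGroup H] [InnerProductSpace ℝ H] {A : H →ₗ[ℝ] H}
  {l α β c μ : ℝ} {φ : H} {W v : ℝ → ℝ}

theorem sqrtNorm_smul_eigenvector (hφ : A φ = μ • φ) {x : ℝ} (hx : 0 ≤ x) :
    sqrtNorm A (x • φ) = Real.sqrt μ * ‖φ‖ * x := by
  rw [sqrtNorm, map_smul, hφ, inner_smul_left, inner_smul_right, inner_smul_left,
    real_inner_self_eq_norm_sq]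
  simp only [conj_trivial]
  rw [show x * (x * (μ * ‖φ‖ ^ 2)) = μ * (‖φ‖ * x) ^ 2 by ring,
    Real.sqrt_mul' _ (sq_nonneg _), Real.sqrt_sq (by positivity), mul_assoc]

theorem dt_smul_of_hasDerivAt (hv : ∀ t, 0 ≤ t → HasDerivAt v (-W (v t)) t) {t : ℝ} (ht : 0 ≤ t) :
    dt (fun t => v t • φ) t = (-W (v t)) • φ :=
  ((hv t ht).smul_const φ).hasDerivWithinAt.derivWithin (uniqueDiffOn_Ici 0 t ht)

/-- Motion along an orbit of the scalar equation, in the direction of an eigenvector, solves the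
vector equation. -/
theorem isSolution_smul_eigenvector (hl : 0 < l) (hφ : A φ = μ • φ) (hφ₀ : φ ≠ 0)
    (hvpos : ∀ t, 0 ≤ t → 0 < v t) (hWpos : ∀ t, 0 ≤ t → 0 < W (v t))
    (hv : ∀ t, 0 ≤ t → HasDerivAt v (-W (v t)) t)
    (hW : ∀ t, 0 ≤ t → HasDerivAt W
      (c * ‖φ‖ ^ α / ((l + 1) * ‖φ‖ ^ l) * W (v t) ^ (α - l) -
        (Real.sqrt μ * ‖φ‖) ^ β * μ / ((l + 1) * ‖φ‖ ^ l) * v t ^ (β + 1) *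
          W (v t) ^ (-(l + 1))) (v t)) :
    IsSolution l β A (powerDamping c α) fun t => v t • φ := by
  have hn : 0 < ‖φ‖ := norm_pos_iff.2 hφ₀
  have hnl : 0 < ‖φ‖ ^ l := Real.rpow_pos_of_pos hn l
  have hl1 : 0 < l + 1 := by linarith
  have hud := uniqueDiffOn_Ici (0 : ℝ)
  have hdt := fun t (ht : 0 ≤ t) => dt_smul_of_hasDerivAt (φ := φ) hv ht
  have hvc : ContinuousOn v (Set.Ici 0) := fun t ht => (hv t ht).continuousAt.continuousWithinAt
  have hwd : ∀ t, 0 ≤ t → HasDerivAt (fun t => W (v t)) _ t := fun t ht =>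
    HasDerivAt.comp t (hW t ht) (hv t ht)
  have hwc : ContinuousOn (fun t => W (v t)) (Set.Ici 0) := fun t ht =>
    (hwd t ht).continuousAt.continuousWithinAt
  have hmom : Set.EqOn (momentum l fun t => v t • φ)
      (fun t => (-(‖φ‖ ^ l * W (v t) ^ (l + 1))) • φ) (Set.Ici 0) := fun t ht => by
    have hw := hWpos t ht
    simp only [momentum]
    rw [hdt t ht, norm_smul, norm_neg, Real.norm_of_nonneg hw.le, Real.mul_rpow hw.le hn.le,
      smul_smul, Real.rpow_add_one hw.ne']
    congr 1
    ring
  have hmomd : ∀ t, 0 ≤ t → HasDerivWithinAt (momentum l fun t => v t • φ)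
      ((c * ‖φ‖ ^ α * W (v t) ^ (α + 1) -
        (Real.sqrt μ * ‖φ‖) ^ β * μ * v t ^ (β + 1)) • φ) (Set.Ici 0) t := fun t ht => by
    have hw := hWpos t ht
    have h := ((((hwd t ht).rpow_const (p := l + 1) (Or.inl hw.ne')).const_mul
      (‖φ‖ ^ l)).neg.smul_const φ).hasDerivWithinAt (s := Set.Ici 0)
    refine (h.congr hmom (hmom ht)).congr_deriv ?_
    congr 1
    have e1 : W (v t) ^ (α + 1) = W (v t) ^ (α - l) * W (v t) ^ l * W (v t) := by
      rw [← Real.rpow_add hw, ← Real.rpow_add_one hw.ne']; congr 1; ring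
    have e2 : W (v t) ^ (-(l + 1)) * W (v t) ^ l * W (v t) = 1 := by
      rw [← Real.rpow_add hw, ← Real.rpow_add_one hw.ne',
        show -(l + 1) + l + 1 = 0 by ring, Real.rpow_zero]
    rw [e1, add_sub_cancel_right]
    field_simp
    linear_combination (-(Real.sqrt μ * ‖φ‖) ^ β * μ * v t ^ (β + 1)) * e2
  have hdmom := fun t (ht : 0 ≤ t) => (hmomd t ht).derivWithin (hud t ht)
  refine ⟨?_, ?_, fun t ht => ?_⟩
  · rw [contDiffOn_one_iff_derivWithin hud]
    exact ⟨fun t ht => ((hv t ht).smul_const φ).differentiableAt.differentiableWithinAt,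
      (hwc.neg.smul continuousOn_const).congr fun t ht => hdt t ht⟩
  · rw [contDiffOn_one_iff_derivWithin hud]
    refine ⟨fun t ht => (hmomd t ht).differentiableWithinAt, ContinuousOn.congr ?_ hdmom⟩
    refine ContinuousOn.smul (.sub (.mul continuousOn_const ?_) (.mul continuousOn_const ?_))
      continuousOn_const
    · exact hwc.rpow_const fun t ht => Or.inl (hWpos t ht).ne'
    · exact hvc.rpow_const fun t ht => Or.inl (hvpos t ht).ne'
  · have hw := hWpos t ht
    have hvt := hvpos t ht
    rw [show dt (momentum l fun t => v t • φ) t = _ from hdmom t ht, hdt t ht,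
      sqrtNorm_smul_eigenvector hφ hvt.le, powerDamping, norm_smul, norm_neg,
      Real.norm_of_nonneg hw.le, map_smul, hφ, Real.mul_rpow hw.le hn.le,
      Real.mul_rpow (by positivity) hvt.le, Real.rpow_add_one hw.ne', Real.rpow_add_one hvt.ne',
      smul_smul, smul_smul, smul_smul, ← add_smul, ← add_smul]
    convert zero_smul ℝ φ using 2
    ring

theorem energy_smul_eigenvector (hφ : A φ = μ • φ) (hvpos : ∀ t, 0 ≤ t → 0 < v t)
    (hWpos : ∀ t, 0 ≤ t → 0 < W (v t)) (hv : ∀ t, 0 ≤ t → HasDerivAt v (-W (v t)) t)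
    {t : ℝ} (ht : 0 ≤ t) :
    energy l β A (fun t => v t • φ) t =
      ((l + 1) / (l + 2) * ‖φ‖ ^ (l + 2)) * W (v t) ^ (l + 2) +
        (1 / (β + 2) * (Real.sqrt μ * ‖φ‖) ^ (β + 2)) * v t ^ (β + 2) := by
  have hw := hWpos t ht
  have hvt := hvpos t ht
  rw [energy, dt_smul_of_hasDerivAt hv ht, sqrtNorm_smul_eigenvector hφ hvt.le, norm_smul, norm_neg,
    Real.norm_of_nonneg hw.le, Real.mul_rpow hw.le (norm_nonneg _),
    Real.mul_rpow (by positivity) hvt.le]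
  ring

/-- A sum of two multiples of powers of `t` is governed by the larger power. -/
theorem isTheta_add_rpow {f g : ℝ → ℝ} {a b K₁ K₂ : ℝ} (hf : f =Θ[atTop] fun t : ℝ => t ^ a)
    (hg : g =Θ[atTop] fun t : ℝ => t ^ b) (hK₁ : K₁ ≠ 0) (hab : b < a) :
    (fun t => K₁ * f t + K₂ * g t) =Θ[atTop] fun t : ℝ => t ^ a := by
  have hlt : (fun t : ℝ => t ^ b) =o[atTop] fun t : ℝ => t ^ a := by
    refine (isLittleO_iff_tendsto' ?_).2 ?_
    · filter_upwards [eventually_gt_atTop 0] with t ht h0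
      exact absurd h0 (Real.rpow_pos_of_pos ht a).ne'
    · refine (tendsto_rpow_neg_atTop (sub_pos.2 hab)).congr' ?_
      filter_upwards [eventually_gt_atTop 0] with t ht
      rw [neg_sub, Real.rpow_sub ht]
  have hf' : (fun t => K₁ * f t) =Θ[atTop] fun t : ℝ => t ^ a :=
    (isTheta_const_mul_left hK₁).2 hf
  exact hf'.add_isLittleO ((hg.1.const_mul_left K₂).trans_isLittleO hlt)

/-- Every orbit comparable to `s ^ θ` at the origin carries infinitely many solutions along the
eigenvector, one for each starting point, and their energy decays at the slower of the rates of
`t ^ (-θ (l + 2) / (θ - 1))` and `t ^ (-(β + 2) / (θ - 1))`. -/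
theorem infinite_solutions_of_orbit {θ m M s₀ : ℝ} (hl : 0 < l) (hβ : 0 < β) (hμ : 0 < μ)
    (hφ : A φ = μ • φ) (hφ₀ : φ ≠ 0) (hθ : 1 < θ) (hm : 0 < m) (hs₀ : 0 < s₀)
    (hW : IsOrbit l α β (c * ‖φ‖ ^ α / ((l + 1) * ‖φ‖ ^ l))
      ((Real.sqrt μ * ‖φ‖) ^ β * μ / ((l + 1) * ‖φ‖ ^ l)) θ m M s₀ W)
    (hne : θ * (l + 2) ≠ β + 2) :
    (onHalfLine fun u => (IsSolution l β A (powerDamping c α) u ∧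
      energy l β A u =Θ[atTop] fun t : ℝ => t ^ (-(min (θ * (l + 2)) (β + 2) / (θ - 1)))) ∧
        IsMultipleOf φ u).Infinite := by
  have hn : 0 < ‖φ‖ := norm_pos_iff.2 hφ₀
  have hsμ : 0 < Real.sqrt μ := Real.sqrt_pos.2 hμ
  have hθ' : 0 < θ - 1 := by linarith
  have hWpos : ∀ s ∈ Set.Ioo 0 s₀, 0 < W s := fun s hs =>
    (mul_pos hm (Real.rpow_pos_of_pos hs.1 θ)).trans_le (hW.lower s hs)
  have hWc : ContinuousOn W (Set.Ioo 0 s₀) := fun s hs =>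
    (hW.hasDerivAt s hs).continuousAt.continuousWithinAt
  have key : ∀ v₀ : Set.Ioo 0 s₀, ∃ u : ℝ → H, u 0 = (v₀ : ℝ) • φ ∧
      (IsSolution l β A (powerDamping c α) u ∧
        energy l β A u =Θ[atTop] fun t : ℝ => t ^ (-(min (θ * (l + 2)) (β + 2) / (θ - 1)))) ∧
      IsMultipleOf φ u := by
    rintro ⟨v₀, hv₀⟩
    obtain ⟨v, hv0, hv, hvΘ⟩ := exists_decaying_motion hθ hm hWc hW.lower hW.upper hv₀
    have hvpos : ∀ t, 0 ≤ t → 0 < v t := fun t ht => (hv t ht).1.1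
    have hwpos : ∀ t, 0 ≤ t → 0 < W (v t) := fun t ht => hWpos _ (hv t ht).1
    have hvd : ∀ t, 0 ≤ t → HasDerivAt v (-W (v t)) t := fun t ht => (hv t ht).2
    refine ⟨fun t => v t • φ, by simp only [hv0], ⟨?_, ?_⟩, v, fun t _ => rfl⟩
    · exact isSolution_smul_eigenvector hl hφ hφ₀ hvpos hwpos hvd
        fun t ht => hW.hasDerivAt _ (hv t ht).1
    have hrpow : ∀ {f : ℝ → ℝ} {a : ℝ} (b : ℝ), (∀ t, 0 ≤ t → 0 < f t) →
        (f =Θ[atTop] fun t : ℝ => t ^ a) →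
        (fun t => f t ^ b) =Θ[atTop] fun t : ℝ => t ^ (a * b) := fun {f a} b hf hfa => by
      have h := hfa.rpow (r := b) ((eventually_ge_atTop 0).mono fun t ht => (hf t ht).le)
        ((eventually_ge_atTop 0).mono fun t ht => Real.rpow_nonneg ht _)
      refine h.trans_eventuallyEq ((eventually_ge_atTop 0).mono fun t ht => ?_)
      exact (Real.rpow_mul ht _ _).symm
    have hwv : (fun t => W (v t)) =Θ[atTop] fun t => v t ^ θ := by
      refine ⟨IsBigO.of_bound M ?_, IsBigO.of_bound m⁻¹ ?_⟩
      · filter_upwards [eventually_ge_atTop 0] with t ht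
        rw [Real.norm_of_nonneg (hwpos t ht).le,
          Real.norm_of_nonneg (Real.rpow_nonneg (hvpos t ht).le _)]
        exact hW.upper _ (hv t ht).1
      · filter_upwards [eventually_ge_atTop 0] with t ht
        rw [Real.norm_of_nonneg (hwpos t ht).le,
          Real.norm_of_nonneg (Real.rpow_nonneg (hvpos t ht).le _), inv_mul_eq_div,
          le_div_iff₀ hm, mul_comm]
        exact hW.lower _ (hv t ht).1
    have h1 := hrpow (l + 2) hwpos (hwv.trans (hrpow θ hvpos hvΘ))
    have h2 := hrpow (β + 2) hvpos hvΘ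
    have hE := (eventually_ge_atTop (0 : ℝ)).mono fun t ht =>
      energy_smul_eigenvector (l := l) (β := β) hφ hvpos hwpos hvd ht
    have hK₁ : (l + 1) / (l + 2) * ‖φ‖ ^ (l + 2) ≠ 0 := by positivity
    have hK₂ : 1 / (β + 2) * (Real.sqrt μ * ‖φ‖) ^ (β + 2) ≠ 0 := by positivity
    refine EventuallyEq.trans_isTheta hE ?_
    rcases hne.lt_or_gt with h | h
    · rw [min_eq_left h.le,
        show -(θ * (l + 2) / (θ - 1)) = -(1 / (θ - 1)) * θ * (l + 2) by ring]
      refine isTheta_add_rpow h1 h2 hK₁ ?_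
      have := mul_lt_mul_of_pos_left h (one_div_pos.2 hθ')
      linarith
    · rw [min_eq_right h.le, show -((β + 2) / (θ - 1)) = -(1 / (θ - 1)) * (β + 2) by ring]
      refine EventuallyEq.trans_isTheta (Eventually.of_forall fun t => add_comm _ _)
        (isTheta_add_rpow h2 h1 hK₂ ?_)
      have := mul_lt_mul_of_pos_left h (one_div_pos.2 hθ')
      linarith
  choose u hu₀ hu using key
  have : Infinite (Set.Ioo 0 s₀) := (Set.Ioo_infinite hs₀).to_subtype
  refine Set.infinite_of_injective_forall_mem
    (f := fun v₀ => (Set.Ici (0 : ℝ)).domRestrict (u v₀)) (fun v₁ v₂ h => ?_)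
    fun v₀ => ⟨u v₀, hu v₀, rfl⟩
  have h0 : u v₁ 0 = u v₂ 0 := congrFun h ⟨0, Set.self_mem_Ici⟩
  rw [hu₀, hu₀] at h0
  exact Subtype.ext (smul_left_injective ℝ hφ₀ h0)

end Eigenvector

theorem mainTheorem6 {H : Type*} [NormedAddCommGroup H] [InnerProductSpace ℝ H]
    [FiniteDimensional ℝ H] [Nontrivial H]
    (A : H →ₗ[ℝ] H) (hA : A.IsSymmetric) (hA' : VectorODE.IsCoerciveOp A)
    (l β α c : ℝ) (hl : 0 < l) (hβ : 0 < β) (hc : 0 < c)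
    (hlα : l < α) (hα : α < (β * (1 + l) + l) / (β + 2)) :
    ((VectorODE.onHalfLine (VectorODE.IsFastSolution l β α c A)).Infinite ∧
      (VectorODE.onHalfLine (VectorODE.IsSlowSolution l β α c A)).Infinite) ∧
    ∀ (μ : ℝ) (φ : H), Module.End.HasEigenvector A μ φ →
      (VectorODE.onHalfLine fun u =>
        VectorODE.IsFastSolution l β α c A u ∧ VectorODE.IsMultipleOf φ u).Infinite ∧
      (VectorODE.onHalfLine fun u =>
        VectorODE.IsSlowSolution l β α c A u ∧ VectorODE.IsMultipleOf φ u).Infinite := by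
  have hαβ : α * (β + 2) < β * (1 + l) + l := (lt_div_iff₀ (by linarith)).1 hα
  have hα1 : α < l + 1 := by nlinarith
  have hβα : α < β := by nlinarith
  have hα0 : 0 < α + 1 := by linarith
  have hlα1 : 0 < l + 1 - α := by linarith
  have main : ∀ (μ : ℝ) (φ : H), Module.End.HasEigenvector A μ φ →
      (onHalfLine fun u => IsFastSolution l β α c A u ∧ IsMultipleOf φ u).Infinite ∧
      (onHalfLine fun u => IsSlowSolution l β α c A u ∧ IsMultipleOf φ u).Infinite := by
    intro μ φ hφ
    have hφA : A φ = μ • φ := hφ.apply_eq_smul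
    have hφ₀ : φ ≠ 0 := hφ.2
    have hn : 0 < ‖φ‖ := norm_pos_iff.2 hφ₀
    have hμ : 0 < μ := by
      obtain ⟨lam, hlam, h⟩ := hA'
      have h := h φ
      rw [hφA, inner_smul_left, real_inner_self_eq_norm_sq] at h
      exact hlam.trans_le (le_of_mul_le_mul_right h (by positivity))
    have hsμ : 0 < Real.sqrt μ := Real.sqrt_pos.2 hμ
    have hC : 0 < c * ‖φ‖ ^ α / ((l + 1) * ‖φ‖ ^ l) := by positivity
    have hB : 0 < (Real.sqrt μ * ‖φ‖) ^ β * μ / ((l + 1) * ‖φ‖ ^ l) := by positivity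
    constructor
    · have hδ : 1 / (l + 1 - α) * (l + 2) < β + 2 := by
        rw [one_div_mul_eq_div, div_lt_iff₀ hlα1]
        nlinarith
      obtain ⟨m, hm, M, s₀, hs₀, W, hW⟩ := exists_fast_orbit
        (B := (Real.sqrt μ * ‖φ‖) ^ β * μ / ((l + 1) * ‖φ‖ ^ l)) hα1 hC hδ
      have h := infinite_solutions_of_orbit hl hβ hμ hφA hφ₀
        ((one_lt_div hlα1).2 (by linarith)) hm hs₀ hW hδ.ne
      have hαl : α - l ≠ 0 := by linarith
      rwa [min_eq_left hδ.le, show 1 / (l + 1 - α) * (l + 2) / (1 / (l + 1 - α) - 1) =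
        (l + 2) / (α - l) by
          rw [show 1 / (l + 1 - α) - 1 = (α - l) / (l + 1 - α) by field_simp; ring]
          field_simp] at h
    · have hθ : 1 < (β + 1) / (α + 1) * (l + 1 - α) := by
        rw [div_mul_eq_mul_div, one_lt_div hα0]
        nlinarith
      have hδ : β + 2 < (β + 1) / (α + 1) * (l + 2) := by
        rw [div_mul_eq_mul_div, lt_div_iff₀ hα0]
        nlinarith
      obtain ⟨m, hm, M, s₀, hs₀, W, hW⟩ := exists_slow_orbit hl hlα hβ hC hB hθ
      have h := infinite_solutions_of_orbit hl hβ hμ hφA hφ₀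
        ((one_lt_div hα0).2 (by linarith)) hm hs₀ hW hδ.ne'
      have hβα' : β - α ≠ 0 := by linarith
      rwa [min_eq_right hδ.le, show (β + 2) / ((β + 1) / (α + 1) - 1) =
        (α + 1) * (β + 2) / (β - α) by
          rw [show (β + 1) / (α + 1) - 1 = (β - α) / (α + 1) by field_simp; ring]
          field_simp] at h
  refine ⟨?_, main⟩
  obtain ⟨φ, hφ⟩ := hA.hasEigenvalue_iSup_of_finiteDimensional.exists_hasEigenvector
  obtain ⟨hfast, hslow⟩ := main _ φ hφ
  exact ⟨hfast.mono (Set.image_mono fun u hu => hu.1),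
    hslow.mono (Set.image_mono fun u hu => hu.1)⟩
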